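/- Let $\mathbb F$ be a field, and let $A(s),B(s)\in\mathbb F[s]^{n\times n}$ be regular matrix pencils (polynomial matrices of degree at most one with nonzero determinant). Let $P(s)\in\mathbb F[s]^{n\times n}$ be a matrix pencil whose rank over the field of fractions of $\mathbb F[s]$ equals $r$, such that $A(s)+P(s)$ is strictly equivalent to $B(s)$, i.e. $A(s)+P(s)=Q\,B(s)\,R$ for some $Q,R\in \mathrm{GL}_n(\mathbb F)$. Then $$m_{i-r}(\lambda,A(s))\le m_i(\lambda,B(s))\le m_{i+r}(\lambda,A(s)),\qquad 1\le i\le n,\quad \lambda\in\overline{\mathbb F}\cup\{\infty\},$$ and, equivalently, $$m_{i-r}(\lambda,B(s))\le m_i(\lambda,A(s))\le m_{i+r}(\lambda,B(s)),\qquad 1\le i\le n,\quad \lambda\in\overline{\mathbb F}\cup\{\infty\}.$$ Here $\overline{\mathbb F}$ is the algebraic closure of $\mathbb F$. For a regular pencil $G(s)=G_0+sG_1\in\mathbb F[s]^{n\times n}$, let $D_k(s)$ be the monic greatest common divisor of its minors of order $k$ ($D_0=1$), and let $\gamma_k=D_k/D_{k-1}$, $1\le k\le n$, be its invariant factors, so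 that $\gamma_1\mid\dots\mid\gamma_n$. For $\lambda\in\overline{\mathbb F}$ and $1\le i\le n$, the partial multiplicity $m_i(\lambda,G(s))$ is the exponent of $s-\lambda$ in the factorization of $\gamma_i(s)$ over $\overline{\mathbb F}$. The partial multiplicity $m_i(\infty,G(s))$ is the exponent of $t$ in the $i$-th invariant factor of $tG_0+G_1\in\mathbb F[t]^{n\times n}$. For every $\lambda\in\overline{\mathbb F}\cup\{\infty\}$, by convention $m_i(\lambda,G(s))=0$ for $i<1$ and $m_i(\lambda,G(s))=\infty$ for $i>n$. -/

import Mathlib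

open scoped Polynomial OnePoint

noncomputable section

namespace MatrixPencil

variable {F : Type*} [Field F] {n : ℕ}

/-- A polynomial matrix is a (square) matrix pencil if it has degree at most one. -/
def IsPencil (G : Matrix (Fin n) (Fin n) F[X]) : Prop :=
  ∀ i j, (G i j).natDegree ≤ 1

/-- A square matrix pencil is regular if its determinant is not the zero polynomial. -/
def IsRegularPencil (G : Matrix (Fin n) (Fin n) F[X]) : Prop :=
  IsPencil G ∧ G.det ≠ 0

/-- The normal rank of a polynomial matrix: its rank over the field of fractions of `F[s]`. -/
def normalRank (G : Matrix (Fin n) (Fin n) F[X]) : ℕ :=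
  (G.map (algebraMap F[X] (RatFunc F))).rank

/-- Strict equivalence: `G(s) = Q H(s) R` with invertible constant matrices `Q`, `R`. -/
def StrictlyEquivalent (G H : Matrix (Fin n) (Fin n) F[X]) : Prop :=
  ∃ Q R : Matrix.GeneralLinearGroup (Fin n) F,
    G = Q.1.map Polynomial.C * H * R.1.map Polynomial.C

/-- The minors of order `k`: determinants of the submatrices formed by `k` rows and `k` columns,
each taken in increasing order. -/
def minors (G : Matrix (Fin n) (Fin n) F[X]) (k : ℕ) : Set F[X] :=
  Set.range fun p : (Fin k ↪o Fin n) × (Fin k ↪o Fin n) => (G.submatrix p.1 p.2).det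

/-- The determinantal divisor `D_k(s)`: the greatest common divisor of the minors of order `k`
(a generator of the ideal they span), made monic. It is `0` when all these minors vanish. -/
def determinantalDivisor (G : Matrix (Fin n) (Fin n) F[X]) (k : ℕ) : F[X] :=
  let d := Submodule.IsPrincipal.generator (Ideal.span (minors G k))
  d * Polynomial.C d.leadingCoeff⁻¹

/-- The invariant factors `γ_k(s) = D_k(s) / D_{k-1}(s)`, `1 ≤ k ≤ rank G`, with `D_0(s) = 1`.
(The division is exact; the value is `1` for `k = 0`, and `0` for `k > rank G`.) -/
def invariantFactor (G : Matrix (Fin n) (Fin n) F[X]) (k : ℕ) : F[X] :=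
  determinantalDivisor G k / determinantalDivisor G (k - 1)

/-- The pencil `t G₀ + G₁` attached to `G(s) = G₀ + s G₁`. -/
def reversal (G : Matrix (Fin n) (Fin n) F[X]) : Matrix (Fin n) (Fin n) F[X] :=
  G.map fun p => Polynomial.X * Polynomial.C (p.coeff 0) + Polynomial.C (p.coeff 1)

/-- The `k`-th partial multiplicity, `1 ≤ k ≤ n`, of a regular pencil at a point of
`F̄ ∪ {∞}`. At a finite `x` it is the exponent of `s - x` in the factorization of `γ_k(s)` over
`F̄`. At `∞` it is the exponent `q` in `γ̄_k(t) = c t^q t^(deg γ_k) γ_k(1/t)`, where `γ̄_k` is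
the `k`-th invariant factor of `t G₀ + G₁`; since `t^(deg γ_k) γ_k(1/t)` does not vanish at
`t = 0`, this is the order of vanishing of `γ̄_k` at `0`. -/
def multiplicityAt (G : Matrix (Fin n) (Fin n) F[X]) (k : ℕ) :
    OnePoint (AlgebraicClosure F) → ℕ
  | ∞ => (invariantFactor (reversal G) k).rootMultiplicity 0
  | (x : AlgebraicClosure F) =>
    ((invariantFactor G k).map (algebraMap F (AlgebraicClosure F))).rootMultiplicity x

/-- The partial multiplicities `m_i(λ, G(s))` for all integers `i`, with the conventions
`m_i = 0` for `i < 1` and `m_i = ∞` for `i > n`. -/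
def partialMultiplicity (G : Matrix (Fin n) (Fin n) F[X]) (i : ℤ)
    (z : OnePoint (AlgebraicClosure F)) : ℕ∞ :=
  if i < 1 then 0
  else if (n : ℤ) < i then ⊤
  else (multiplicityAt G i.toNat z : ℕ∞)

end MatrixPencil

end

namespace MatrixPencil

/-! Fix a finite point x. Taylor expansion at x embeds the polynomials into the discrete valuation
ring K[[X]], where a regular pencil has a Smith form `U * diag(X ^ m i) * W` with `m` monotone. The
exponents are the partial multiplicities at x, because ideals of minors commute with ring maps and
ignore invertible factors.

The core is `smith_exponent_le_of_rank_le`: if `A' - A` has rank at most r, then m_i ≤ m'_{i+r}.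
Otherwise a dimension count gives v ≠ 0 with Av = A'v, such that Wv has no component at the
exponents of A before m_i and W'v none at those of A' after m'_{i+r}. Comparing powers of the
uniformizer forces it to divide v; the quotient satisfies the same conditions, so the division never
stops, which is absurd.

The point ∞ reduces to 0 through the reversal tG(1/t). The roles of A and A + P are symmetric, and
strict equivalence passes to B, so one inequality yields all four bounds. -/

/-- The ideal spanned by the minors of order `k` of a square matrix. -/
def minorIdeal {R : Type*} [CommRing R] {n : ℕ} (G : Matrix (Fin n) (Fin n) R) (k : ℕ) : Ideal R :=
  Ideal.span (Set.range fun p : (Fin k ↪o Fin n) × (Fin k ↪o Fin n) => (G.submatrix p.1 p.2).det)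

/-! ### Ideals of minors -/

section MinorIdeal

variable {R : Type*} [CommRing R] {n : ℕ}

theorem exists_orderEmbedding_comp_perm {k : ℕ} {f : Fin k → Fin n} (hf : Function.Injective f) :
    ∃ (g : Fin k ↪o Fin n) (σ : Equiv.Perm (Fin k)), f = g ∘ σ := by
  have hs : StrictMono (f ∘ Tuple.sort f) :=
    (Tuple.monotone_sort f).strictMono_of_injective (hf.comp (Tuple.sort f).injective)
  refine ⟨OrderEmbedding.ofStrictMono _ hs, (Tuple.sort f)⁻¹, ?_⟩
  funext i
  simp

/-- Repeated indices give zero and sorting costs only a sign, so later expansions need not track the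
order of rows and columns. -/
theorem det_submatrix_mem_minorIdeal (G : Matrix (Fin n) (Fin n) R) {k : ℕ}
    (f g : Fin k → Fin n) : (G.submatrix f g).det ∈ minorIdeal G k := by
  by_cases hf : Function.Injective f
  swap
  · obtain ⟨i, j, hij, hne⟩ : ∃ i j, f i = f j ∧ i ≠ j := by
      simpa [Function.Injective] using hf
    rw [Matrix.det_zero_of_row_eq hne (by funext l; simp [hij])]
    exact zero_mem _
  by_cases hg : Function.Injective g
  swap
  · obtain ⟨i, j, hij, hne⟩ : ∃ i j, g i = g j ∧ i ≠ j := by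
      simpa [Function.Injective] using hg
    rw [Matrix.det_zero_of_column_eq hne (by intro l; simp [hij])]
    exact zero_mem _
  obtain ⟨f', σ, rfl⟩ := exists_orderEmbedding_comp_perm hf
  obtain ⟨g', τ, rfl⟩ := exists_orderEmbedding_comp_perm hg
  have h : G.submatrix (f' ∘ σ) (g' ∘ τ) = ((G.submatrix f' g').submatrix σ id).submatrix id τ := rfl
  rw [h, Matrix.det_permute', Matrix.det_permute]
  exact Ideal.mul_mem_left _ _ (Ideal.mul_mem_left _ _ (Ideal.subset_span ⟨(f', g'), rfl⟩))

theorem minorIdeal_le_iff {G : Matrix (Fin n) (Fin n) R} {k : ℕ} {I : Ideal R} :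
    minorIdeal G k ≤ I ↔
      ∀ f g : Fin k ↪o Fin n, (G.submatrix f g).det ∈ I := by
  simp [minorIdeal, Ideal.span_le, Set.range_subset_iff]

/-- Each row of `U * G` is a combination of rows of `G`; expand the minor by multilinearity. -/
theorem minorIdeal_mul_left_le (U G : Matrix (Fin n) (Fin n) R) (k : ℕ) :
    minorIdeal (U * G) k ≤ minorIdeal G k := by
  rw [minorIdeal_le_iff]
  intro f g
  have h : (U * G).submatrix f g = fun i => ∑ j : Fin n, U (f i) j • fun l => G j (g l) := by
    funext i l
    simp [Matrix.mul_apply]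
  rw [h]
  change (Matrix.detRowAlternating : (Fin k → R) [⋀^Fin k]→ₗ[R] R).toMultilinearMap _ ∈ _
  rw [MultilinearMap.map_sum]
  refine Ideal.sum_mem _ fun c _ => ?_
  rw [MultilinearMap.map_smul_univ]
  exact Ideal.mul_mem_left _ _ (det_submatrix_mem_minorIdeal G c g)

theorem minorIdeal_transpose (G : Matrix (Fin n) (Fin n) R) (k : ℕ) :
    minorIdeal G.transpose k = minorIdeal G k := by
  have h (H : Matrix (Fin n) (Fin n) R) : minorIdeal H.transpose k ≤ minorIdeal H k := by
    rw [minorIdeal_le_iff]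
    intro f g
    rw [← Matrix.det_transpose]
    exact det_submatrix_mem_minorIdeal H g f
  exact le_antisymm (h G) (h G.transpose)

theorem minorIdeal_mul_right_le (G W : Matrix (Fin n) (Fin n) R) (k : ℕ) :
    minorIdeal (G * W) k ≤ minorIdeal G k := by
  rw [← minorIdeal_transpose, Matrix.transpose_mul, ← minorIdeal_transpose G]
  exact minorIdeal_mul_left_le _ _ _

theorem minorIdeal_mul_mul_of_isUnit {U W : Matrix (Fin n) (Fin n) R} (hU : IsUnit U)
    (hW : IsUnit W) (G : Matrix (Fin n) (Fin n) R) (k : ℕ) :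
    minorIdeal (U * G * W) k = minorIdeal G k := by
  refine le_antisymm ((minorIdeal_mul_right_le _ _ _).trans (minorIdeal_mul_left_le _ _ _)) ?_
  obtain ⟨U', hU'⟩ := hU.exists_left_inv
  obtain ⟨W', hW'⟩ := hW.exists_right_inv
  have h : G = U' * (U * G * W) * W' := by
    rw [mul_assoc, mul_assoc, hW', mul_one, ← mul_assoc, hU', one_mul]
  conv_lhs => rw [h]
  exact (minorIdeal_mul_right_le _ _ _).trans (minorIdeal_mul_left_le _ _ _)

theorem minorIdeal_succ_le (G : Matrix (Fin n) (Fin n) R) (k : ℕ) :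
    minorIdeal G (k + 1) ≤ minorIdeal G k := by
  rw [minorIdeal_le_iff]
  intro f g
  rw [Matrix.det_succ_row_zero]
  refine Ideal.sum_mem _ fun j _ => Ideal.mul_mem_left _ _ ?_
  rw [Matrix.submatrix_submatrix]
  exact det_submatrix_mem_minorIdeal _ _ _

theorem minorIdeal_map {S : Type*} [CommRing S] (φ : R →+* S) (G : Matrix (Fin n) (Fin n) R)
    (k : ℕ) : minorIdeal (G.map φ) k = (minorIdeal G k).map φ := by
  rw [minorIdeal, minorIdeal, Ideal.map_span, ← Set.range_comp]
  congr 2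
  funext p
  simp [RingHom.map_det, Matrix.submatrix_map]

theorem val_le_orderEmbedding_apply {k : ℕ} (g : Fin k ↪o Fin n) (i : Fin k) :
    (i : ℕ) ≤ g i := by
  obtain ⟨i, hi⟩ := i
  induction i with
  | zero => exact Nat.zero_le _
  | succ i ih =>
    have h := g.strictMono (show (⟨i, by omega⟩ : Fin k) < ⟨i + 1, hi⟩ from Nat.lt_succ_self i)
    exact (ih (by omega)).trans_lt h

/-- An increasing embedding satisfies `i ≤ g i`, so with monotone exponents the leading minor
divides all others of its order. -/
theorem minorIdeal_diagonal_pow (p : R) {m : Fin n → ℕ} (hm : Monotone m) {k : ℕ} (hk : k ≤ n) :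
    minorIdeal (Matrix.diagonal fun i => p ^ m i) k =
      Ideal.span {p ^ ∑ i : Fin k, m (Fin.castLE hk i)} := by
  apply le_antisymm
  · rw [minorIdeal_le_iff]
    intro f g
    rw [Matrix.det_apply]
    refine Ideal.sum_mem _ fun σ _ => ?_
    rw [Units.smul_def, zsmul_eq_mul]
    refine Ideal.mul_mem_left _ _ (Ideal.mem_span_singleton.2 ?_)
    rw [← Finset.prod_pow_eq_pow_sum]
    refine Finset.prod_dvd_prod_of_dvd _ _ fun i _ => ?_
    rw [Matrix.submatrix_apply, Matrix.diagonal_apply]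
    split_ifs with h
    · rw [h]
      refine pow_dvd_pow _ (hm ?_)
      exact val_le_orderEmbedding_apply g i
    · exact dvd_zero _
  · rw [Ideal.span_singleton_le_iff_mem]
    convert det_submatrix_mem_minorIdeal _ (Fin.castLE hk) (Fin.castLE hk)
    rw [Matrix.submatrix_diagonal _ _ (Fin.castLE_injective hk), Matrix.det_diagonal,
      ← Finset.prod_pow_eq_pow_sum]
    rfl

end MinorIdeal

/-! ### Smith form and interlacing by descent -/

theorem forall_dvd_mulVec {V : Type*} [CommRing V] {n : ℕ} {q : V} (U : Matrix (Fin n) (Fin n) V) {v : Fin n → V}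
    (hv : ∀ i, q ∣ v i) (i : Fin n) : q ∣ U.mulVec v i := by
  change q ∣ ∑ j, U i j * v j
  exact Finset.dvd_sum fun j _ => Dvd.dvd.mul_left (hv j) (U i j)

theorem forall_dvd_of_forall_dvd_mulVec {V : Type*} [CommRing V] {n : ℕ} {q : V} {U : Matrix (Fin n) (Fin n) V} (hU : IsUnit U)
    {v : Fin n → V} (hv : ∀ i, q ∣ U.mulVec v i) (i : Fin n) : q ∣ v i := by
  obtain ⟨U', hU'⟩ := hU.exists_left_inv
  have h := forall_dvd_mulVec U' hv i
  rwa [Matrix.mulVec_mulVec, hU', Matrix.one_mulVec] at h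

section SmithForm

variable {V : Type*} [CommRing V] [IsDomain V] {n : ℕ}

/-- `A` is injective, so its range has full rank and admits an adapted basis, which is pulled back
through `A`. -/
theorem exists_smith_form_diagonal [IsPrincipalIdealRing V] (A : Matrix (Fin n) (Fin n) V)
    (hA : A.det ≠ 0) :
    ∃ (b c : Module.Basis (Fin n) V (Fin n → V)) (a : Fin n → V),
      (∀ i, a i ≠ 0) ∧ ∀ i, A.mulVec (c i) = a i • b i := by
  have hinj : Function.Injective A.mulVecLin := by
    rw [← LinearMap.ker_eq_bot, LinearMap.ker_eq_bot']
    intro v hv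
    exact Matrix.eq_zero_of_mulVec_eq_zero hA hv
  let e := LinearEquiv.ofInjective A.mulVecLin hinj
  obtain ⟨b, a, ab, h⟩ := Submodule.exists_smith_normal_form_of_rank_eq (Pi.basisFun V (Fin n))
    e.finrank_eq.symm
  have hc (i) : A.mulVec (ab.map e.symm i) = a i • b i := by
    rw [← h i, Module.Basis.map_apply]
    exact congrArg Subtype.val (e.apply_symm_apply (ab i))
  refine ⟨b, ab.map e.symm, a, fun i hi => ?_, hc⟩
  refine ab.ne_zero i (Subtype.coe_injective ?_)
  change (ab i : Fin n → V) = 0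
  rw [h i, hi, zero_smul]

/-- Smith normal form over a discrete valuation ring, with uniformizer `p`. -/
theorem exists_smith_form [IsDiscreteValuationRing V] {p : V} (hp : Irreducible p)
    (A : Matrix (Fin n) (Fin n) V) (hA : A.det ≠ 0) :
    ∃ (U W : Matrix (Fin n) (Fin n) V) (m : Fin n → ℕ), IsUnit U ∧ IsUnit W ∧ Monotone m ∧
      A = U * (Matrix.diagonal fun i => p ^ m i) * W := by
  obtain ⟨b, c, a, ha, h⟩ := exists_smith_form_diagonal A hA
  choose m u hu using fun i => IsDiscreteValuationRing.eq_unit_mul_pow_irreducible (ha i) hp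
  -- Units are absorbed into the target basis, and both bases are reordered to make the exponents
  -- monotone.
  let σ := Tuple.sort m
  let b' := (b.unitsSMul u).reindex σ.symm
  let c' := c.reindex σ.symm
  let s := Pi.basisFun V (Fin n)
  have hD : LinearMap.toMatrix c' b' (Matrix.toLin' A) =
      Matrix.diagonal fun i => p ^ (m ∘ σ) i := by
    have hcb (j) : Matrix.toLin' A (c' j) = p ^ m (σ j) • b' j := by
      simp only [Matrix.toLin'_apply, b', c', Module.Basis.reindex_apply, Equiv.symm_symm, h, hu,
        Module.Basis.unitsSMul_apply, Units.smul_def, smul_smul]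
      rw [mul_comm]
    ext i j
    rw [LinearMap.toMatrix_apply, hcb, map_smul, Module.Basis.repr_self, Matrix.diagonal_apply]
    by_cases hij : i = j
    · subst hij; simp
    · simp [hij]
  have hI {x y : Module.Basis (Fin n) V (Fin n → V)} : IsUnit (x.toMatrix y) :=
    IsUnit.of_mul_eq_one _ (Module.Basis.toMatrix_mul_toMatrix_flip x y)
  refine ⟨s.toMatrix b', c'.toMatrix s, m ∘ σ, hI, hI, Tuple.monotone_sort m, ?_⟩
  rw [← hD, basis_toMatrix_mul_linearMap_toMatrix_mul_basis_toMatrix]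
  exact (LinearMap.toMatrix'_toLin' A).symm

/-- Homogeneous linear conditions of total rank less than `n` have a nonzero integral solution. -/
theorem exists_integral_solution {K : Type*} [Field K] [Algebra V K] [IsFractionRing V K]
    (P W W' : Matrix (Fin n) (Fin n) V) {r : ℕ} (hP : (P.map (algebraMap V K)).rank ≤ r)
    {i : ℕ} (hi : i + r < n) :
    ∃ v : Fin n → V, v ≠ 0 ∧ P.mulVec v = 0 ∧ (∀ j : Fin n, (j : ℕ) < i → W.mulVec v j = 0) ∧
      ∀ j : Fin n, i + r < j → W'.mulVec v j = 0 := by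
  let ι := algebraMap V K
  -- Restricting the codomain to the range makes `P` count for at most r conditions. The total is
  -- then at most r + i + (n - (i + r + 1)) = n - 1.
  let f₁ : (Fin n → K) →ₗ[K] LinearMap.range (P.map ι).mulVecLin := (P.map ι).mulVecLin.rangeRestrict
  let f₂ : (Fin n → K) →ₗ[K] (Fin i → K) :=
    LinearMap.funLeft K K (Fin.castLE (show i ≤ n by omega)) ∘ₗ (W.map ι).mulVecLin
  let f₃ : (Fin n → K) →ₗ[K] (Fin (n - (i + r + 1)) → K) :=
    LinearMap.funLeft K K (fun j => ⟨i + r + 1 + j, by omega⟩) ∘ₗ (W'.map ι).mulVecLin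
  have hlt : Module.finrank K (LinearMap.range (P.map ι).mulVecLin × (Fin i → K) ×
      (Fin (n - (i + r + 1)) → K)) < Module.finrank K (Fin n → K) := by
    have : Module.finrank K (LinearMap.range (P.map ι).mulVecLin) ≤ r := hP
    simp only [Module.finrank_prod, Module.finrank_fin_fun]
    omega
  obtain ⟨x, hx, hx0⟩ := (Submodule.ne_bot_iff _).1
    (LinearMap.ker_ne_bot_of_finrank_lt (f := f₁.prod (f₂.prod f₃)) hlt)
  obtain ⟨b, hb⟩ := IsLocalization.exist_integer_multiples_of_finite (nonZeroDivisors V) x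
  choose v hv using hb
  have hb0 : ι b ≠ 0 := IsLocalization.to_map_ne_zero_of_mem_nonZeroDivisors K le_rfl b.2
  have hv' : ι ∘ v = ι b • x := by
    funext j
    simp only [Function.comp_apply, Pi.smul_apply, smul_eq_mul]
    exact (hv j).trans (Algebra.smul_def _ _)
  have key (M : Matrix (Fin n) (Fin n) V) (j : Fin n) :
      M.mulVec v j = 0 ↔ (M.map ι).mulVec x j = 0 := by
    rw [← map_eq_zero_iff ι (IsFractionRing.injective V K), RingHom.map_mulVec, hv',
      Matrix.mulVec_smul, Pi.smul_apply, smul_eq_zero_iff_right hb0]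
  simp only [LinearMap.ker_prod, Submodule.mem_inf, LinearMap.mem_ker] at hx
  obtain ⟨h₁, h₂, h₃⟩ := hx
  refine ⟨v, ?_, ?_, ?_, ?_⟩
  · rintro rfl
    refine hx0 ((smul_eq_zero_iff_right hb0).1 (hv'.symm.trans ?_))
    funext j
    simp
  · funext j
    exact (key P j).2 (congrFun (congrArg Subtype.val h₁) j)
  · intro j hj
    exact (key W j).2 (congrFun h₂ ⟨j, hj⟩)
  · intro j hj
    have hj' : j = ⟨i + r + 1 + (j - (i + r + 1)), by omega⟩ := by
      ext
      change (j : ℕ) = i + r + 1 + (j - (i + r + 1))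
      omega
    rw [key, hj']
    exact congrFun h₃ ⟨j - (i + r + 1), by omega⟩

/-- Interlacing of the Smith invariants of two matrices whose difference has rank at most `r`. -/
theorem smith_exponent_le_of_rank_le {K : Type*} [Field K] [Algebra V K] [IsFractionRing V K]
    [WfDvdMonoid V] {p : V} (hp : Prime p) {A A' U W U' W' : Matrix (Fin n) (Fin n) V}
    {m m' : Fin n → ℕ} (hU' : IsUnit U') (hW' : IsUnit W')
    (hm : Monotone m) (hm' : Monotone m')
    (hA : A = U * (Matrix.diagonal fun i => p ^ m i) * W)
    (hA' : A' = U' * (Matrix.diagonal fun i => p ^ m' i) * W')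
    {r : ℕ} (hr : ((A' - A).map (algebraMap V K)).rank ≤ r) {i j : Fin n} (hij : (i : ℕ) + r = j) :
    m i ≤ m' j := by
  by_contra! hlt
  have descent (v : Fin n → V) (hP : (A' - A).mulVec v = 0)
      (h : ∀ l : Fin n, l < i → W.mulVec v l = 0) (h' : ∀ l : Fin n, j < l → W'.mulVec v l = 0)
      (l : Fin n) : p ∣ v l := by
    refine forall_dvd_of_forall_dvd_mulVec hW' (fun l => ?_) l
    rcases lt_or_ge j l with hl | hl
    · rw [h' l hl]
      exact dvd_zero p
    have hAv (l) : p ^ m i ∣ A.mulVec v l := by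
      rw [hA, ← Matrix.mulVec_mulVec, ← Matrix.mulVec_mulVec]
      refine forall_dvd_mulVec U (fun l => ?_) l
      rw [Matrix.mulVec_diagonal]
      rcases lt_or_ge l i with hl | hl
      · rw [h l hl, mul_zero]
        exact dvd_zero _
      · exact Dvd.dvd.mul_right (pow_dvd_pow p (hm hl)) _
    rw [Matrix.sub_mulVec, sub_eq_zero] at hP
    rw [← hP, hA', ← Matrix.mulVec_mulVec, ← Matrix.mulVec_mulVec] at hAv
    have hDv := forall_dvd_of_forall_dvd_mulVec hU' hAv l
    rw [Matrix.mulVec_diagonal] at hDv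
    -- For l ≤ j the exponent `m' l` falls short of `m i`, so a factor `p` is left over for the
    -- coordinate of `W'v`.
    have hml : m' l + 1 ≤ m i := (hm' hl).trans_lt hlt
    have := (pow_dvd_pow p hml).trans hDv
    rw [pow_succ] at this
    exact (mul_dvd_mul_iff_left (pow_ne_zero _ hp.ne_zero)).1 this
  -- The three conditions are linear and homogeneous, so they survive division by `p` and the
  -- descent repeats.
  have hdvd (e : ℕ) : ∀ v : Fin n → V, (A' - A).mulVec v = 0 →
      (∀ l : Fin n, l < i → W.mulVec v l = 0) → (∀ l : Fin n, j < l → W'.mulVec v l = 0) →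
      ∀ l, p ^ e ∣ v l := by
    induction e with
    | zero => simp
    | succ e ih =>
      intro v hP h h' l
      choose w hw using descent v hP h h'
      have hv : v = p • w := funext hw
      subst hv
      have hz (M : Matrix (Fin n) (Fin n) V) (l) : M.mulVec (p • w) l = 0 ↔ M.mulVec w l = 0 := by
        rw [Matrix.mulVec_smul, Pi.smul_apply, smul_eq_zero_iff_right hp.ne_zero]
      rw [Pi.smul_apply, smul_eq_mul, pow_succ']
      refine mul_dvd_mul_left p (ih w (funext fun l => (hz _ l).1 (congrFun hP l))
        (fun l hl => (hz _ l).1 (h l hl)) (fun l hl => (hz _ l).1 (h' l hl)) l)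
  obtain ⟨v, hv0, hP, h, h'⟩ := exists_integral_solution (K := K) (A' - A) W W' hr
    (i := i) (by omega)
  obtain ⟨l, hl⟩ := Function.ne_iff.1 hv0
  obtain ⟨e, q, hq, hvq⟩ := WfDvdMonoid.max_power_factor hl hp.irreducible
  have := hdvd (e + 1) v hP (fun l hl => h l hl) (fun l hl => h' l (by omega)) l
  rw [hvq, pow_succ] at this
  exact hq ((mul_dvd_mul_iff_left (pow_ne_zero _ hp.ne_zero)).1 this)

end SmithForm

/-! ### Invariant factors read off a local Smith form -/

section InvariantFactors

variable {F : Type*} [Field F] {n : ℕ}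

theorem span_determinantalDivisor (G : Matrix (Fin n) (Fin n) F[X]) (k : ℕ) :
    Ideal.span {determinantalDivisor G k} = minorIdeal G k := by
  have hgen : Ideal.span {Submodule.IsPrincipal.generator (minorIdeal G k)} = minorIdeal G k :=
    Ideal.span_singleton_generator _
  change Ideal.span {Submodule.IsPrincipal.generator (minorIdeal G k) *
    Polynomial.C (Submodule.IsPrincipal.generator (minorIdeal G k)).leadingCoeff⁻¹} = _
  by_cases h : Submodule.IsPrincipal.generator (minorIdeal G k) = 0
  · rw [h, zero_mul, ← hgen, h]
  · rw [Ideal.span_singleton_mul_right_unit, hgen]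
    exact Polynomial.isUnit_C.2 (IsUnit.mk0 _ (inv_ne_zero (Polynomial.leadingCoeff_ne_zero.2 h)))

theorem determinantalDivisor_congr {G H : Matrix (Fin n) (Fin n) F[X]} {k : ℕ}
    (h : minorIdeal G k = minorIdeal H k) :
    determinantalDivisor G k = determinantalDivisor H k := by
  have h' : Ideal.span (minors G k) = Ideal.span (minors H k) := h
  simp only [determinantalDivisor, h']

theorem invariantFactor_congr {G H : Matrix (Fin n) (Fin n) F[X]}
    (h : ∀ k, minorIdeal G k = minorIdeal H k) (k : ℕ) :
    invariantFactor G k = invariantFactor H k := by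
  rw [invariantFactor, invariantFactor, determinantalDivisor_congr (h _),
    determinantalDivisor_congr (h _)]

variable {V : Type*} [CommRing V] [IsDomain V]

theorem associated_map_determinantalDivisor {φ : F[X] →+* V} {p : V}
    {G : Matrix (Fin n) (Fin n) F[X]} {U W : Matrix (Fin n) (Fin n) V} {m : Fin n → ℕ}
    (hU : IsUnit U) (hW : IsUnit W) (hm : Monotone m)
    (hG : G.map φ = U * (Matrix.diagonal fun i => p ^ m i) * W) {k : ℕ} (hk : k ≤ n) :
    Associated (φ (determinantalDivisor G k)) (p ^ ∑ i : Fin k, m (Fin.castLE hk i)) := by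
  rw [← Ideal.span_singleton_eq_span_singleton, ← minorIdeal_diagonal_pow p hm hk,
    ← minorIdeal_mul_mul_of_isUnit hU hW, ← hG, minorIdeal_map, ← span_determinantalDivisor,
    Ideal.map_span, Set.image_singleton]

theorem associated_map_invariantFactor {φ : F[X] →+* V} {p : V} (hp : p ≠ 0)
    {G : Matrix (Fin n) (Fin n) F[X]} {U W : Matrix (Fin n) (Fin n) V} {m : Fin n → ℕ}
    (hU : IsUnit U) (hW : IsUnit W) (hm : Monotone m)
    (hG : G.map φ = U * (Matrix.diagonal fun i => p ^ m i) * W) (i : Fin n) :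
    Associated (φ (invariantFactor G (i + 1))) (p ^ m i) := by
  have h₀ := associated_map_determinantalDivisor hU hW hm hG (k := i) (by omega)
  have h₁ := associated_map_determinantalDivisor hU hW hm hG (k := i + 1) (by omega)
  rw [Fin.sum_univ_castSucc, pow_add] at h₁
  have hdvd : determinantalDivisor G i ∣ determinantalDivisor G (i + 1) := by
    rw [← Ideal.span_singleton_le_span_singleton, span_determinantalDivisor,
      span_determinantalDivisor]
    exact minorIdeal_succ_le G i
  have hne : determinantalDivisor G i ≠ 0 := by
    intro h
    rw [h, map_zero] at h₀
    exact pow_ne_zero _ hp ((associated_zero_iff_eq_zero _).1 h₀.symm)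
  have hmul : determinantalDivisor G i * invariantFactor G (i + 1) =
      determinantalDivisor G (i + 1) := EuclideanDomain.mul_div_cancel' hne hdvd
  rw [← hmul, map_mul] at h₁
  refine Associated.of_mul_left h₁ h₀ fun h => ?_
  rw [h] at h₀
  exact pow_ne_zero _ hp ((associated_zero_iff_eq_zero _).1 h₀.symm)

end InvariantFactors

/-! ### Taylor expansion and root multiplicity -/

section LocalExpansion

variable {K : Type*} [Field K]

/-- Expansion of a polynomial as a power series in `X - x`. -/
noncomputable def expansion (x : K) : K[X] →+* PowerSeries K :=
  Polynomial.coeToPowerSeries.ringHom.comp (Polynomial.taylorAlgHom x : K[X] →+* K[X])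

theorem expansion_apply (x : K) (q : K[X]) :
    expansion x q = (Polynomial.taylor x q : PowerSeries K) := rfl

theorem expansion_injective (x : K) : Function.Injective (expansion x) := fun _ _ h =>
  Polynomial.taylor_injective x (Polynomial.coe_injective K h)

theorem expansion_X_sub_C (x : K) : expansion x (Polynomial.X - Polynomial.C x) = PowerSeries.X := by
  simp [expansion_apply]

theorem isUnit_expansion {x : K} {q : K[X]} (hq : ¬ (Polynomial.X - Polynomial.C x) ∣ q) :
    IsUnit (expansion x q) := by
  rw [PowerSeries.isUnit_iff_constantCoeff, expansion_apply]
  rw [Polynomial.dvd_iff_isRoot] at hq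
  simpa [Polynomial.taylor_coeff_zero] using hq

/-- The cofactor of the largest power of X - x does not vanish at x, so it expands to a unit and
only that power matters. -/
theorem rootMultiplicity_eq_of_associated_expansion {x : K} {q : K[X]} {m : ℕ}
    (h : Associated (expansion x q) (PowerSeries.X ^ m)) : q.rootMultiplicity x = m := by
  have hX : (PowerSeries.X : PowerSeries K) ≠ 0 := PowerSeries.X_ne_zero
  have hq : q ≠ 0 := by
    rintro rfl
    rw [map_zero] at h
    exact pow_ne_zero _ hX ((associated_zero_iff_eq_zero _).1 h.symm)
  obtain ⟨g, hg, hdvd⟩ := q.exists_eq_pow_rootMultiplicity_mul_and_not_dvd hq x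
  generalize q.rootMultiplicity x = e at hg
  rw [hg, map_mul, map_pow, expansion_X_sub_C] at h
  have h' : Associated ((PowerSeries.X : PowerSeries K) ^ e) (PowerSeries.X ^ m) :=
    (associated_mul_unit_right _ _ (isUnit_expansion hdvd)).trans h
  exact le_antisymm ((pow_dvd_pow_iff hX PowerSeries.X_irreducible.not_isUnit).1 h'.dvd)
    ((pow_dvd_pow_iff hX PowerSeries.X_irreducible.not_isUnit).1 h'.symm.dvd)

end LocalExpansion

/-! ### Rank under field homomorphisms -/

section Rank

/-- The rank normal form factors through dimension `M.rank`, and this factorization survives `f`. -/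
theorem rank_map_le {K L : Type*} [Field K] [Field L] (f : K →+* L) {n : ℕ}
    (M : Matrix (Fin n) (Fin n) K) : (M.map f).rank ≤ M.rank := by
  classical
  obtain ⟨V, U, e, hV, hU, h⟩ := Matrix.exists_rank_normal_form M
  obtain ⟨V', hV'⟩ := hV.exists_left_inv
  obtain ⟨U', hU'⟩ := hU.exists_right_inv
  have hM : M = V' * (V * M * U) * U' := by
    rw [mul_assoc, mul_assoc, hU', mul_one, ← mul_assoc, hV', one_mul]
  rw [h] at hM
  have hD : (((Matrix.fromBlocks 1 0 0 0 : Matrix (Fin M.rank ⊕ Fin (Fintype.card (Fin n) - M.rank))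
      (Fin M.rank ⊕ Fin (Fintype.card (Fin n) - M.rank)) K).submatrix e e).map f).rank ≤ M.rank := by
    have hfac : (((Matrix.fromBlocks 1 0 0 0 :
        Matrix (Fin M.rank ⊕ Fin (Fintype.card (Fin n) - M.rank))
        (Fin M.rank ⊕ Fin (Fintype.card (Fin n) - M.rank)) K).submatrix e e).map f) =
        ((Matrix.fromRows 1 0 : Matrix (Fin M.rank ⊕ Fin (Fintype.card (Fin n) - M.rank))
          (Fin M.rank) L).submatrix e id) * ((Matrix.fromCols 1 0 :
          Matrix (Fin M.rank) (Fin M.rank ⊕ Fin (Fintype.card (Fin n) - M.rank)) L).submatrix id e)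
        := by
      rw [← Matrix.submatrix_mul _ _ e id e Function.bijective_id, Matrix.fromRows_mul_fromCols,
        ← Matrix.submatrix_map, Matrix.fromBlocks_map]
      simp
    rw [hfac]
    exact (Matrix.rank_mul_le_left _ _).trans (Matrix.rank_le_width _)
  have hmap := congrArg (fun N => (N.map f).rank) hM
  simp only [Matrix.map_mul] at hmap
  rw [hmap]
  exact (Matrix.rank_mul_le_left _ _).trans ((Matrix.rank_mul_le_right _ _).trans hD)

theorem rank_map_le_normalRank {F L : Type*} [Field F] [Field L] {ψ : F[X] →+* L}
    (hψ : Function.Injective ψ) {n : ℕ} (P : Matrix (Fin n) (Fin n) F[X]) :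
    (P.map ψ).rank ≤ normalRank P := by
  have h : P.map ψ = (P.map (algebraMap F[X] (RatFunc F))).map (IsFractionRing.lift hψ) := by
    ext i j
    simp
  rw [h]
  exact rank_map_le _ _

end Rank

/-! ### Interlacing at a finite point -/

section Interlacing

variable {F : Type*} [Field F] {n r : ℕ}

/-- Interlacing of the local exponents of the invariant factors under a perturbation of
normal rank at most `r`. -/
theorem rootMultiplicity_invariantFactor_le {K : Type*} [Field K] (f : F →+* K) (x : K)
    {A A' : Matrix (Fin n) (Fin n) F[X]} (hA : A.det ≠ 0) (hA' : A'.det ≠ 0)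
    (hr : normalRank (A' - A) ≤ r) {i : ℕ} (hi : 1 ≤ i) (hin : i + r ≤ n) :
    ((invariantFactor A i).map f).rootMultiplicity x ≤
      ((invariantFactor A' (i + r)).map f).rootMultiplicity x := by
  let φ : F[X] →+* PowerSeries K := (expansion x).comp (Polynomial.mapRingHom f)
  have hφ : Function.Injective φ :=
    (expansion_injective x).comp (Polynomial.map_injective f f.injective)
  have hdet {B : Matrix (Fin n) (Fin n) F[X]} (hB : B.det ≠ 0) : (B.map φ).det ≠ 0 := by
    rw [← RingHom.mapMatrix_apply, ← RingHom.map_det]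
    exact (map_ne_zero_iff φ hφ).2 hB
  obtain ⟨U, W, m, hU, hW, hm, hs⟩ := exists_smith_form PowerSeries.X_irreducible _ (hdet hA)
  obtain ⟨U', W', m', hU', hW', hm', hs'⟩ := exists_smith_form PowerSeries.X_irreducible _ (hdet hA')
  have hrank : ((A'.map φ - A.map φ).map
      (algebraMap (PowerSeries K) (FractionRing (PowerSeries K)))).rank ≤ r := by
    refine le_trans ?_ hr
    have hinj : Function.Injective
        ((algebraMap (PowerSeries K) (FractionRing (PowerSeries K))).comp φ) :=
      (IsFractionRing.injective _ _).comp hφ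
    have hmap : (A'.map φ - A.map φ).map
        (algebraMap (PowerSeries K) (FractionRing (PowerSeries K))) =
        (A' - A).map ((algebraMap (PowerSeries K) (FractionRing (PowerSeries K))).comp φ) := by
      ext1 a b
      simp only [Matrix.map_apply, Matrix.sub_apply, RingHom.comp_apply, map_sub]
    rw [hmap]
    exact rank_map_le_normalRank hinj (A' - A)
  -- Invariant factors are numbered from 1, Smith exponents from 0.
  have hle := smith_exponent_le_of_rank_le PowerSeries.X_prime hU' hW' hm hm' hs hs' hrank
    (i := ⟨i - 1, by omega⟩) (j := ⟨i + r - 1, by omega⟩) (by simp only; omega)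
  have h := associated_map_invariantFactor PowerSeries.X_ne_zero hU hW hm hs ⟨i - 1, by omega⟩
  have h' := associated_map_invariantFactor PowerSeries.X_ne_zero hU' hW' hm' hs'
    ⟨i + r - 1, by omega⟩
  simp only [Nat.sub_add_cancel hi, Nat.sub_add_cancel (show 1 ≤ i + r by omega)] at h h'
  rwa [← rootMultiplicity_eq_of_associated_expansion h,
    ← rootMultiplicity_eq_of_associated_expansion h'] at hle

end Interlacing

/-! ### The point at infinity -/

section Reversal

variable {F : Type*} [Field F] {n : ℕ}

/-- The substitution `s ↦ 1 / s`. -/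
noncomputable def invSubst (F : Type*) [Field F] : F[X] →ₐ[F] RatFunc F :=
  Polynomial.aeval (RatFunc.X⁻¹ : RatFunc F)

theorem invSubst_injective : Function.Injective (invSubst F) := by
  refine transcendental_iff_injective.1 fun h => ?_
  exact RatFunc.transcendental_X (IsAlgebraic.inv_iff.1 h)

/-- The identity tG₀ + G₁ = tG(1/t) transfers rank bounds and nonvanishing determinants to the
reversal. -/
theorem map_reversal {G : Matrix (Fin n) (Fin n) F[X]} (hG : IsPencil G) :
    (reversal G).map (algebraMap F[X] (RatFunc F)) = (RatFunc.X : RatFunc F) • G.map (invSubst F) := by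
  ext i j
  have h := Polynomial.eq_X_add_C_of_natDegree_le_one (hG i j)
  rw [Matrix.smul_apply, Matrix.map_apply, Matrix.map_apply, reversal, Matrix.map_apply]
  generalize (G i j).coeff 0 = a at h ⊢
  generalize (G i j).coeff 1 = b at h ⊢
  rw [h]
  have hX : (RatFunc.X : RatFunc F) ≠ 0 := RatFunc.X_ne_zero
  simp [invSubst, mul_add]
  field_simp
  ring

theorem det_reversal_ne_zero {G : Matrix (Fin n) (Fin n) F[X]} (hG : IsRegularPencil G) :
    (reversal G).det ≠ 0 := by
  have h := congrArg Matrix.det (map_reversal hG.1)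
  rw [Matrix.det_smul, ← RingHom.mapMatrix_apply, ← RingHom.map_det] at h
  have h' : (G.map (invSubst F)).det = invSubst F G.det := ((invSubst F).toRingHom.map_det G).symm
  rw [h'] at h
  intro h0
  rw [h0, map_zero] at h
  exact mul_ne_zero (pow_ne_zero _ RatFunc.X_ne_zero)
    ((map_ne_zero_iff _ invSubst_injective).2 hG.2) h.symm

theorem normalRank_reversal_le {G : Matrix (Fin n) (Fin n) F[X]} (hG : IsPencil G) :
    normalRank (reversal G) ≤ normalRank G := by
  rw [normalRank, map_reversal hG, Matrix.rank_smul_of_mem_nonZeroDivisors _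
    (mem_nonZeroDivisors_of_ne_zero RatFunc.X_ne_zero)]
  exact rank_map_le_normalRank (ψ := (invSubst F).toRingHom) invSubst_injective G

theorem reversal_sub (G H : Matrix (Fin n) (Fin n) F[X]) :
    reversal (G - H) = reversal G - reversal H := by
  ext1 i j
  simp [reversal]
  ring

theorem IsPencil.sub {G H : Matrix (Fin n) (Fin n) F[X]} (hG : IsPencil G) (hH : IsPencil H) :
    IsPencil (G - H) := fun i j =>
  (Polynomial.natDegree_sub_le _ _).trans (max_le (hG i j) (hH i j))

theorem reversal_mul_mul {B : Matrix (Fin n) (Fin n) F[X]} (Q R : Matrix (Fin n) (Fin n) F)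
    (hB : IsPencil B) (h : IsPencil (Q.map Polynomial.C * B * R.map Polynomial.C)) :
    reversal (Q.map Polynomial.C * B * R.map Polynomial.C) =
      Q.map Polynomial.C * reversal B * R.map Polynomial.C := by
  apply Matrix.map_injective (IsFractionRing.injective F[X] (RatFunc F))
  have hC (M : Matrix (Fin n) (Fin n) F) :
      (M.map Polynomial.C).map (algebraMap F[X] (RatFunc F)) =
        (M.map Polynomial.C).map (invSubst F) := by
    ext
    simp [invSubst]
  beta_reduce
  rw [map_reversal h, Matrix.map_mul, Matrix.map_mul, Matrix.map_mul, Matrix.map_mul,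
    map_reversal hB, hC, hC, mul_smul_comm, smul_mul_assoc]

end Reversal

/-! ### Partial multiplicities and their conventions -/

section Multiplicities

variable {F : Type*} [Field F] {n r : ℕ}

theorem isUnit_map_C (Q : Matrix.GeneralLinearGroup (Fin n) F) :
    IsUnit (Q.1.map Polynomial.C : Matrix (Fin n) (Fin n) F[X]) :=
  Q.isUnit.map (Polynomial.C : F →+* F[X]).mapMatrix

theorem multiplicityAt_congr {G H : Matrix (Fin n) (Fin n) F[X]} (hG : IsPencil G)
    (hH : IsPencil H) (h : StrictlyEquivalent G H) (k : ℕ)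
    (z : OnePoint (AlgebraicClosure F)) : multiplicityAt G k z = multiplicityAt H k z := by
  obtain ⟨Q, R, rfl⟩ := h
  cases z with
  | infty =>
    change ((invariantFactor (reversal _) k).rootMultiplicity 0) =
      (invariantFactor (reversal _) k).rootMultiplicity 0
    rw [reversal_mul_mul _ _ hH hG, invariantFactor_congr
      (minorIdeal_mul_mul_of_isUnit (isUnit_map_C Q) (isUnit_map_C R) (reversal H))]
  | coe x =>
    change ((invariantFactor _ k).map _).rootMultiplicity x =
      ((invariantFactor _ k).map _).rootMultiplicity x
    rw [invariantFactor_congr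
      (minorIdeal_mul_mul_of_isUnit (isUnit_map_C Q) (isUnit_map_C R) H)]

theorem multiplicityAt_le {A A' : Matrix (Fin n) (Fin n) F[X]} (hA : IsRegularPencil A)
    (hA' : IsRegularPencil A') (hr : normalRank (A' - A) ≤ r) {i : ℕ} (hi : 1 ≤ i)
    (hin : i + r ≤ n) (z : OnePoint (AlgebraicClosure F)) :
    multiplicityAt A i z ≤ multiplicityAt A' (i + r) z := by
  cases z with
  | infty =>
    have h := rootMultiplicity_invariantFactor_le (RingHom.id F) 0 (det_reversal_ne_zero hA)
      (det_reversal_ne_zero hA') (r := r) (by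
        rw [← reversal_sub]
        exact (normalRank_reversal_le (hA'.1.sub hA.1)).trans hr) hi hin
    rwa [Polynomial.map_id, Polynomial.map_id] at h
  | coe x => exact rootMultiplicity_invariantFactor_le _ x hA.2 hA'.2 hr hi hin

theorem partialMultiplicity_le_add {A A' : Matrix (Fin n) (Fin n) F[X]} (hA : IsRegularPencil A)
    (hA' : IsRegularPencil A') (hr : normalRank (A' - A) ≤ r) (i : ℤ)
    (z : OnePoint (AlgebraicClosure F)) :
    partialMultiplicity A i z ≤ partialMultiplicity A' (i + r) z := by
  unfold partialMultiplicity
  -- Out of range, the left side is 0 or the right side is ⊤; otherwise both indices lie in 1, …, n.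
  by_cases h₁ : i < 1
  · rw [if_pos h₁]
    exact zero_le
  by_cases h₂ : (n : ℤ) < i + r
  · rw [if_neg (by omega : ¬ i + r < 1), if_pos h₂]
    exact le_top
  rw [if_neg h₁, if_neg (by omega), if_neg (by omega), if_neg h₂, Nat.cast_le,
    show (i + r).toNat = i.toNat + r by omega]
  exact multiplicityAt_le hA hA' hr (by omega) (by omega) z

theorem normalRank_neg (G : Matrix (Fin n) (Fin n) F[X]) : normalRank (-G) = normalRank G := by
  rw [normalRank, normalRank, show (-G).map (algebraMap F[X] (RatFunc F)) =
    (-1 : RatFunc F) • G.map (algebraMap F[X] (RatFunc F)) by ext; simp]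
  exact Matrix.rank_smul_of_mem_nonZeroDivisors _ (mem_nonZeroDivisors_of_ne_zero (by simp))

theorem IsRegularPencil.of_strictlyEquivalent {G H : Matrix (Fin n) (Fin n) F[X]}
    (hG : IsPencil G) (hH : IsRegularPencil H) (h : StrictlyEquivalent G H) :
    IsRegularPencil G := by
  refine ⟨hG, ?_⟩
  obtain ⟨Q, R, rfl⟩ := h
  rw [Matrix.det_mul, Matrix.det_mul]
  have hdet (M : Matrix.GeneralLinearGroup (Fin n) F) :
      (M.1.map Polynomial.C : Matrix (Fin n) (Fin n) F[X]).det ≠ 0 :=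
    ((Matrix.isUnit_iff_isUnit_det _).1 (isUnit_map_C M)).ne_zero
  exact mul_ne_zero (mul_ne_zero (hdet Q) hH.2) (hdet R)

end Multiplicities

end MatrixPencil

theorem corollary4p3 {F : Type*} [Field F] {n r : ℕ}
    (A B P : Matrix (Fin n) (Fin n) F[X])
    (hA : MatrixPencil.IsRegularPencil A) (hB : MatrixPencil.IsRegularPencil B)
    (hP : MatrixPencil.IsPencil P) (hr : MatrixPencil.normalRank P = r)
    (hAPB : MatrixPencil.StrictlyEquivalent (A + P) B) :
    (∀ (i : ℤ) (z : OnePoint (AlgebraicClosure F)), 1 ≤ i → i ≤ n →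
      MatrixPencil.partialMultiplicity A (i - r) z ≤ MatrixPencil.partialMultiplicity B i z ∧
      MatrixPencil.partialMultiplicity B i z ≤ MatrixPencil.partialMultiplicity A (i + r) z) ∧
    (∀ (i : ℤ) (z : OnePoint (AlgebraicClosure F)), 1 ≤ i → i ≤ n →
      MatrixPencil.partialMultiplicity B (i - r) z ≤ MatrixPencil.partialMultiplicity A i z ∧
      MatrixPencil.partialMultiplicity A i z ≤ MatrixPencil.partialMultiplicity B (i + r) z) := by
  have hAP : MatrixPencil.IsPencil (A + P) := fun i j =>
    (Polynomial.natDegree_add_le _ _).trans (max_le (hA.1 i j) (hP i j))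
  have hAP' := MatrixPencil.IsRegularPencil.of_strictlyEquivalent hAP hB hAPB
  have hcongr (i : ℤ) (z : OnePoint (AlgebraicClosure F)) :
      MatrixPencil.partialMultiplicity (A + P) i z = MatrixPencil.partialMultiplicity B i z := by
    simp only [MatrixPencil.partialMultiplicity,
      MatrixPencil.multiplicityAt_congr hAP hB.1 hAPB]
  have hAB (i : ℤ) (z : OnePoint (AlgebraicClosure F)) :
      MatrixPencil.partialMultiplicity A i z ≤ MatrixPencil.partialMultiplicity B (i + r) z := by
    rw [← hcongr]
    exact MatrixPencil.partialMultiplicity_le_add hA hAP' (by rw [add_sub_cancel_left, hr]) i z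
  have hBA (i : ℤ) (z : OnePoint (AlgebraicClosure F)) :
      MatrixPencil.partialMultiplicity B i z ≤ MatrixPencil.partialMultiplicity A (i + r) z := by
    rw [← hcongr]
    refine MatrixPencil.partialMultiplicity_le_add hAP' hA (le_of_eq ?_) i z
    rw [show A - (A + P) = -P by abel, MatrixPencil.normalRank_neg, hr]
  refine ⟨fun i z _ _ => ⟨?_, hBA i z⟩, fun i z _ _ => ⟨?_, hAB i z⟩⟩
  -- Each lower bound is the other pencil's upper bound at the shifted index.
  · simpa using hAB (i - r) z
  · simpa using hBA (i - r) z
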